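/- All graphs are finite and simple. For a graph $G$ and integers $0\le m\le n$, let $f_G(n,m)$ be the least $k$ such that every collection of $k$ (not necessarily distinct) independent sets $I_1,\dots,I_k$ of $G$, each of size $n$, has a rainbow independent $m$-set, that is, an independent set of $m$ distinct vertices $x_1,\dots,x_m$ of $G$ with $x_j\in I_{i_j}$ for some pairwise distinct indices $i_1,\dots,i_m$. Let $C_\ell$ be the cycle with $\ell$ vertices. Theorem. Suppose that $f_{C_\ell}(m,m)=m$ for all integers $m\ge 1$ and $\ell\ge 2m+1$. Then for every integer $n\ge 1$ and every graph $G$ of maximum degree at most $2$ such that at most four connected components of $G$ are cycles of even length and $G$ has an independent set of size $n$, we have $f_G(n,n-1)=n-1$. -/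

import Mathlib

namespace RainbowIndep

/-- `R` is a rainbow independent `m`-set of the collection `F 0, …, F (k - 1)` of vertex sets
(repetitions allowed) in `G`: an independent set of `m` vertices whose elements can be chosen
from members of the collection with pairwise distinct indices. -/
def IsRainbowIndepSet {V : Type*} (G : SimpleGraph V) {k : ℕ} (F : Fin k → Finset V)
    (m : ℕ) (R : Finset V) : Prop :=
  G.IsNIndepSet m R ∧ ∃ c : R → Fin k, Function.Injective c ∧ ∀ v : R, (v : V) ∈ F (c v)

/-- Every collection of `k` (not necessarily distinct) independent `n`-sets of `G` has a rainbow
independent `m`-set. -/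
def ForcesRainbow {V : Type*} (G : SimpleGraph V) (n m k : ℕ) : Prop :=
  ∀ F : Fin k → Finset V, (∀ i, G.IsNIndepSet n (F i)) → ∃ R : Finset V, IsRainbowIndepSet G F m R

/-- The number `f_G(n, m)`: the least `k` such that every `k` independent `n`-sets of `G` have a
rainbow independent `m`-set (and `⊤` if there is no such `k`). -/
noncomputable def rainbowNumber {V : Type*} (G : SimpleGraph V) (n m : ℕ) : ℕ∞ :=
  ⨅ (k : ℕ) (_ : ForcesRainbow G n m k), (k : ℕ∞)

/-- The number `c_e(G)` of connected components of `G` that are isomorphic to a cycle of even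
length. -/
noncomputable def numEvenCycles {V : Type*} (G : SimpleGraph V) : ℕ∞ :=
  Set.encard {C : G.ConnectedComponent |
    ∃ l : ℕ, 3 ≤ l ∧ Even l ∧ Nonempty (C.toSimpleGraph ≃g SimpleGraph.cycleGraph l)}

end RainbowIndep

/-! The lower bound is immediate: a rainbow set with `n - 1` vertices uses `n - 1` distinct indices.
For the upper bound, let `k = n - 1` independent sets of size `k + 1` be given. Each component of
`G` is an induced subgraph of a cycle of some length `L`, and each given set is to be assigned to
one component, from which its representative is taken. Different components do not interact, so it
suffices that the sets sent to a component have independent representatives there.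

If `m` sets are sent to a component and each has at least `m` vertices in it, the hypothesis on
cycles supplies the representatives when `m` is at most the capacity `c = ⌊(L - 1) / 2⌋`. A trace of
a set on the component has at most `c + 1` vertices, and equality forces `L` to be even and the
trace to be one of the two alternating classes. Then `c + 1` sets can still be served if their
traces are the same class.

The combinatorial core is `exists_assignment`, about the matrix of trace sizes, whose row sums
exceed the number of rows. If some column has `c + 1` full rows of one type, they are assigned to it
and both are deleted; the surplus of the row sums survives. Otherwise each column has at most `2 *
c` full entries, and `exists_assignment_of_card_le` applies: an optimal partial assignment that
misses a row is refuted by alternating exchanges and a double count of the full entries. -/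

namespace RainbowIndep

open Finset

/-! ### Distributing the rows of a matrix among its columns -/

section Assignment

variable {ι J : Type*} [Fintype ι] [DecidableEq J]

/-- The number of rows that a partial assignment sends to column `j`. -/
def load (g : ι → Option J) (j : J) : ℕ := #{k | g k = some j}

/-- A partial assignment is admissible for `b` if each row `i` sent to `j` has `b i j` at least
the load of `j`. -/
def Admissible (b : ι → J → ℕ) (g : ι → Option J) : Prop :=
  ∀ i j, g i = some j → load g j ≤ b i j

/-- The contribution of the row `i` to the weight of a partial assignment. -/
def rowWeight (b : ι → J → ℕ) (g : ι → Option J) (i : ι) : ℕ :=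
  (g i).elim 0 fun j => b i j + 1

/-- An admissible partial assignment of maximum total weight. -/
def IsOptimal (b : ι → J → ℕ) (g : ι → Option J) : Prop :=
  Admissible b g ∧ ∀ h, Admissible b h → ∑ i, rowWeight b h i ≤ ∑ i, rowWeight b g i

lemma exists_isOptimal [Fintype J] (b : ι → J → ℕ) : ∃ g, IsOptimal b g := by
  classical
  obtain ⟨g, hg, hmax⟩ := Finset.exists_max_image
    (univ.filter fun g : ι → Option J => Admissible b g) (fun g => ∑ i, rowWeight b g i)
    ⟨fun _ => none, mem_filter.2 ⟨mem_univ _, fun i j h => by simp at h⟩⟩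
  exact ⟨g, (mem_filter.1 hg).2, fun h hh => hmax h (by simpa using hh)⟩

lemma load_comp_equiv (g : ι → Option J) (e : Equiv.Perm ι) (j : J) :
    load (g ∘ e) j = load g j := by
  unfold load
  refine card_bij (fun k _ => e k) (by simp) (fun _ _ _ _ h => e.injective h) ?_
  intro k hk
  exact ⟨e.symm k, by simpa using hk, by simp⟩

lemma Admissible.comp_swap [DecidableEq ι] {b : ι → J → ℕ} {g : ι → Option J} (hg : Admissible b g)
    {i k : ι} {j : J} (hi : g i = none) (hk : g k = some j) (hb : load g j ≤ b i j) :
    Admissible b (g ∘ Equiv.swap i k) := by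
  intro l j' hl
  rw [load_comp_equiv]
  rw [Function.comp_apply] at hl
  by_cases h1 : l = i
  · subst h1
    rw [Equiv.swap_apply_left, hk, Option.some_inj] at hl
    exact hl ▸ hb
  by_cases h2 : l = k
  · subst h2
    simp [hi] at hl
  · rw [Equiv.swap_apply_of_ne_of_ne h1 h2] at hl
    exact hg l j' hl

lemma sum_rowWeight_comp_swap {ι J : Type*} [Fintype ι] [DecidableEq ι] (b : ι → J → ℕ)
    {g : ι → Option J}
    {i k : ι} {j : J} (hi : g i = none) (hk : g k = some j) :
    ∑ l, rowWeight b (g ∘ Equiv.swap i k) l + b k j = ∑ l, rowWeight b g l + b i j := by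
  have hne : k ≠ i := by
    rintro rfl
    simp [hi] at hk
  have hk' : k ∈ (univ.erase i : Finset ι) := by simp [hne]
  have hrest : ∑ l ∈ (univ.erase i).erase k, rowWeight b (g ∘ Equiv.swap i k) l
      = ∑ l ∈ (univ.erase i).erase k, rowWeight b g l := by
    refine sum_congr rfl fun l hl => ?_
    simp only [mem_erase, mem_univ, and_true] at hl
    simp [rowWeight, Equiv.swap_apply_of_ne_of_ne hl.2 hl.1]
  rw [← add_sum_erase univ _ (mem_univ i), ← add_sum_erase _ _ hk', hrest,
    ← add_sum_erase univ (rowWeight b g) (mem_univ i), ← add_sum_erase _ (rowWeight b g) hk']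
  simp [rowWeight, hi, hk]
  ring

lemma IsOptimal.comp_swap [DecidableEq ι] {b : ι → J → ℕ} {g : ι → Option J} (hg : IsOptimal b g)
    {i k : ι} {j : J} (hi : g i = none) (hk : g k = some j) (hb : load g j ≤ b i j)
    (hbk : b k j ≤ b i j) : IsOptimal b (g ∘ Equiv.swap i k) := by
  refine ⟨hg.1.comp_swap hi hk hb, fun h hh => ?_⟩
  have := sum_rowWeight_comp_swap b hi hk
  have := hg.2 h hh
  lia

/-- If `b i j` exceeded the load, then either every row in column `j` tolerates one more and `i` can
be added, or some row `k` there has `b k j ≤ load g j < b i j` and replacing `k` by `i` increases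
the weight. -/
lemma IsOptimal.le_load {b : ι → J → ℕ} {g : ι → Option J} (hg : IsOptimal b g)
    {i : ι} (hi : g i = none) (j : J) : b i j ≤ load g j := by
  classical
  by_contra! hlt
  by_cases hall : ∀ k, g k = some j → load g j + 1 ≤ b k j
  · set h : ι → Option J := Function.update g i (some j) with hdef
    have hself : load h j = load g j + 1 := by
      unfold load
      rw [← card_insert_of_notMem (a := i) (by simp [hi])]
      congr 1
      ext k
      by_cases hk : k = i <;> simp [hdef, hk]
    have hother : ∀ j', j' ≠ j → load h j' = load g j' := by
      intro j' hj'
      unfold load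
      congr 1
      ext k
      by_cases hk : k = i
      · simp [hdef, hk, hi, hj'.symm]
      · simp [hdef, hk]
    have hadm : Admissible b h := by
      intro k j' hk
      by_cases hki : k = i
      · subst hki
        have : j = j' := by simpa [hdef] using hk
        subst this
        lia
      · rw [hdef, Function.update_of_ne hki] at hk
        by_cases hj' : j' = j
        · subst hj'
          rw [hself]
          exact hall k hk
        · rw [hother j' hj']
          exact hg.1 k j' hk
    have hle := hg.2 h hadm
    rw [← add_sum_erase univ _ (mem_univ i),
      ← add_sum_erase univ (rowWeight b g) (mem_univ i)] at hle
    have : ∑ l ∈ univ.erase i, rowWeight b h l = ∑ l ∈ univ.erase i, rowWeight b g l := by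
      refine sum_congr rfl fun l hl => ?_
      have hl' : l ≠ i := by simpa using hl
      simp [rowWeight, hdef, hl']
    rw [this] at hle
    simp [rowWeight, hdef, hi] at hle
  · push Not at hall
    obtain ⟨k, hk, hkb⟩ := hall
    have h1 := hg.2 _ (hg.1.comp_swap hi hk hlt.le)
    have h2 := sum_rowWeight_comp_swap b hi hk
    lia

lemma sum_load_lt [Fintype J] {g : ι → Option J} {i : ι} (hi : g i = none) :
    ∑ j, load g j < Fintype.card ι := by
  have h := card_eq_sum_card_fiberwise (f := g) (s := univ) (t := univ) (by simp)
  rw [Fintype.sum_option, card_univ] at h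
  have : 0 < #{k | g k = none} := card_pos.2 ⟨i, by simpa using hi⟩
  unfold load
  lia

/-- Rows reachable from the unassigned ones in `n` steps, a step leading from a row `i` to the rows
assigned to a saturated column in which `i` attains the capacity. -/
def reach (b : ι → J → ℕ) (c : J → ℕ) (g : ι → Option J) : ℕ → Set ι
  | 0 => {i | g i = none}
  | n + 1 => reach b c g n ∪
      {k | ∃ i ∈ reach b c g n, ∃ j, load g j = c j ∧ b i j = c j ∧ g k = some j}

/-- Exchanges along an alternating path free any reachable row. Each one puts a row attaining the
capacity into a saturated column, so it stays admissible and loses no weight. Agreement with `g`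
outside the rows reached so far ensures that the next row to be displaced is still in its original
column. -/
lemma exists_isOptimal_of_mem_reach {b : ι → J → ℕ} {c : J → ℕ} (hbc : ∀ i j, b i j ≤ c j)
    {g : ι → Option J} (hg : IsOptimal b g) (n : ℕ) :
    ∀ i ∈ reach b c g n, ∃ g', IsOptimal b g' ∧ (∀ j, load g' j = load g j) ∧ g' i = none ∧
      ∀ k ∉ reach b c g n, g' k = g k := by
  classical
  induction n with
  | zero => exact fun i hi => ⟨g, hg, fun _ => rfl, hi, fun _ _ => rfl⟩
  | succ n ih =>
    intro k hk
    by_cases hkn : k ∈ reach b c g n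
    · obtain ⟨g', h1, h2, h3, h4⟩ := ih k hkn
      exact ⟨g', h1, h2, h3, fun l hl => h4 l fun hl' => hl (Or.inl hl')⟩
    · obtain ⟨i, hi, j, hj, hbj, hgk⟩ := hk.resolve_left hkn
      obtain ⟨g', h1, h2, h3, h4⟩ := ih i hi
      have hk' : g' k = some j := (h4 k hkn).trans hgk
      refine ⟨g' ∘ Equiv.swap i k, h1.comp_swap h3 hk' (by rw [h2, hj, hbj])
        (by rw [hbj]; exact hbc k j), fun l => (load_comp_equiv _ _ _).trans (h2 l),
        by simpa using h3, fun l hl => ?_⟩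
      have hli : l ≠ i := fun h => hl (Or.inl (h ▸ hi))
      have hlk : l ≠ k := fun h => hl (h ▸ hk)
      rw [Function.comp_apply, Equiv.swap_apply_of_ne_of_ne hli hlk]
      exact h4 l fun hl' => hl (Or.inl hl')

/-- Suppose every row sum of `a` exceeds the number of rows, the entries of column `j` are at most
`c j + 1`, and at most `2 * c j` of them equal `c j + 1`. Then the rows can be distributed among
the columns so that column `j` receives at most `c j` rows, and no more than the entry in `j` of
any of them. -/
theorem exists_assignment_of_card_le [Fintype J] (a : ι → J → ℕ) (c : J → ℕ) (ha : ∀ i j, a i j ≤ c j + 1)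
    (hfull : ∀ j, #{i | a i j = c j + 1} ≤ 2 * c j)
    (hsum : ∀ i, Fintype.card ι + 1 ≤ ∑ j, a i j) :
    ∃ g : ι → J, ∀ i, #{k | g k = g i} ≤ min (a i (g i)) (c (g i)) := by
  classical
  set b : ι → J → ℕ := fun i j => min (a i j) (c j) with hb
  have hbc : ∀ i j, b i j ≤ c j := fun i j => min_le_right _ _
  obtain ⟨g, hg⟩ := exists_isOptimal b
  by_cases hnone : ∃ u, g u = none
  swap
  · have hsome : ∀ i, ∃ j, g i = some j := fun i =>
      Option.ne_none_iff_exists'.1 fun h => hnone ⟨i, h⟩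
    choose f hf using hsome
    refine ⟨f, fun i => ?_⟩
    have := hg.1 i (f i) (hf i)
    simpa [load, hf, hb] using this
  exfalso
  obtain ⟨u, hu⟩ := hnone
  have hload : ∀ j, load g j ≤ c j := by
    intro j
    by_cases h : ∃ k, g k = some j
    · obtain ⟨k, hk⟩ := h
      exact (hg.1 k j hk).trans (hbc k j)
    · have : load g j = 0 := by
        rw [load, card_eq_zero, filter_eq_empty_iff]
        exact fun k _ hk => h ⟨k, hk⟩
      lia
  set X : Finset ι := univ.filter fun i => ∃ n, i ∈ reach b c g n with hX
  have hXb : ∀ i ∈ X, ∀ j, b i j ≤ load g j := by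
    intro i hi j
    obtain ⟨n, hn⟩ := (mem_filter.1 hi).2
    obtain ⟨g', h1, h2, h3, -⟩ := exists_isOptimal_of_mem_reach hbc hg n i hn
    exact h2 j ▸ h1.le_load h3 j
  set K : Finset J := univ.filter fun j => load g j = c j ∧ ∃ i ∈ X, b i j = c j with hK
  -- A row of `X` has sum at least the number of rows plus one, while the loads sum to at most the
  -- number of rows minus one. Capped entries do not exceed the loads and capping costs at most one
  -- per column, so at least two entries were capped.
  have htwo : ∀ i ∈ X, 2 ≤ #{j ∈ K | a i j = c j + 1} := by
    intro i hi
    have hEq : ({j ∈ K | a i j = c j + 1} : Finset J) = univ.filter fun j => a i j = c j + 1 := by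
      ext j
      simp only [hK, mem_filter, mem_univ, true_and, and_iff_right_iff_imp]
      intro hj
      have hbj : b i j = c j := by simp [hb, hj]
      exact ⟨le_antisymm (hload j) (hbj ▸ hXb i hi j), i, hi, hbj⟩
    rw [hEq, card_filter]
    have h1 : ∑ j, a i j ≤ ∑ j, load g j + ∑ j, if a i j = c j + 1 then 1 else 0 := by
      rw [← sum_add_distrib]
      refine sum_le_sum fun j _ => ?_
      have := hXb i hi j
      have := ha i j
      simp only [hb] at *
      split_ifs <;> lia
    have := hsum i
    have := sum_load_lt hu
    lia
  -- Every row assigned to a column of `K` is reachable, each such column is saturated, and the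
  -- unassigned row `u` is an extra element of `X`.
  have hcard : ∑ j ∈ K, c j + 1 ≤ #X := by
    have hdisj : (K : Set J).PairwiseDisjoint fun j => univ.filter fun k => g k = some j := by
      intro j _ j' _ hne
      refine disjoint_filter.2 fun k _ h1 h2 => hne ?_
      rw [h1] at h2
      exact Option.some_inj.1 h2
    have huK : u ∉ K.biUnion fun j => univ.filter fun k => g k = some j := by
      simp [hu]
    have hsub : insert u (K.biUnion fun j => univ.filter fun k => g k = some j) ⊆ X := by
      intro k hk
      rw [mem_insert, mem_biUnion] at hk
      rcases hk with rfl | ⟨j, hj, hk⟩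
      · exact mem_filter.2 ⟨mem_univ _, 0, hu⟩
      · obtain ⟨hl, i, hi, hbi⟩ := (mem_filter.1 hj).2
        obtain ⟨n, hn⟩ := (mem_filter.1 hi).2
        exact mem_filter.2 ⟨mem_univ _, n + 1, Or.inr ⟨i, hn, j, hl, hbi, (mem_filter.1 hk).2⟩⟩
    refine le_trans ?_ (card_le_card hsub)
    rw [card_insert_of_notMem huK, card_biUnion hdisj]
    refine Nat.add_le_add_right (sum_le_sum fun j hj => ?_) 1
    exact ((mem_filter.1 hj).2.1).ge
  -- Counting full entries in `X × K` by rows and by columns gives `2 * #X ≤ 2 * ∑ j ∈ K, c j`,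
  -- against `hcard`.
  have hcount : ∑ i ∈ X, #{j ∈ K | a i j = c j + 1} = ∑ j ∈ K, #{i ∈ X | a i j = c j + 1} :=
    sum_card_bipartiteAbove_eq_sum_card_bipartiteBelow fun i j => a i j = c j + 1
  have hlow : #X * 2 ≤ ∑ i ∈ X, #{j ∈ K | a i j = c j + 1} := by
    simpa using card_nsmul_le_sum X _ 2 htwo
  have hupp : ∑ j ∈ K, #{i ∈ X | a i j = c j + 1} ≤ 2 * ∑ j ∈ K, c j := by
    rw [mul_sum]
    exact sum_le_sum fun j _ => (card_le_card (filter_subset_filter _ (subset_univ X))).trans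
      (hfull j)
  lia

end Assignment

/-- Suppose every row sum of `a` exceeds the number of rows, and the entries of column `j` are at
most `c j + 1`. The predicate `p` splits the rows of each column into two types. Then the rows can
be distributed among the columns so that column `j` receives no more rows than the entry in `j` of
any of them, and so that if it receives more than `c j`, then these rows have the same type. -/
theorem exists_assignment {ι J : Type*} [Fintype ι] [Fintype J] [DecidableEq J]
    (a : ι → J → ℕ) (c : J → ℕ) (p : ι → J → Prop)
    (ha : ∀ i j, a i j ≤ c j + 1) (hsum : ∀ i, Fintype.card ι + 1 ≤ ∑ j, a i j) :
    ∃ g : ι → J, (∀ i, #{k | g k = g i} ≤ a i (g i)) ∧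
      ∀ j, #{k | g k = j} ≤ c j ∨ ∀ i i', g i = j → g i' = j → (p i j ↔ p i' j) := by
  classical
  obtain ⟨N, hN⟩ : ∃ N, Fintype.card J = N := ⟨_, rfl⟩
  induction N generalizing ι J with
  | zero =>
    have hJ : IsEmpty J := Fintype.card_eq_zero_iff.1 hN
    have hι : IsEmpty ι := ⟨fun i => by simpa using hsum i⟩
    exact ⟨isEmptyElim, isEmptyElim, isEmptyElim⟩
  | succ N ih =>
    by_cases hmono : ∃ j, ∃ S : Finset ι, #S = c j + 1 ∧ (∀ i ∈ S, a i j = c j + 1) ∧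
        ∀ i ∈ S, ∀ i' ∈ S, (p i j ↔ p i' j)
    -- Deleting column `j` lowers a row sum by at most `c j + 1`, which is exactly the number of
    -- rows deleted, so the hypothesis on row sums is inherited.
    · obtain ⟨j, S, hS, hSa, hSp⟩ := hmono
      have hcardι : Fintype.card {i // i ∉ S} + (c j + 1) = Fintype.card ι := by
        rw [← hS, Fintype.card_subtype_compl, Fintype.card_coe]
        exact Nat.sub_add_cancel (card_le_univ S)
      obtain ⟨g, hg1, hg2⟩ := ih (ι := {i // i ∉ S}) (J := {j' // j' ≠ j})
        (fun i l => a i l) (fun l => c l) (fun i l => p i l) (fun i l => ha i l)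
        (fun i => by
          have h1 := hsum i
          rw [Fintype.sum_eq_add_sum_subtype_ne _ j] at h1
          have h2 := ha i j
          lia)
        (by
          rw [Fintype.card_subtype_compl, hN]
          simp)
      set f : ι → J := fun i => if h : i ∈ S then j else (g ⟨i, h⟩ : J) with hf
      have hfS : ∀ i ∈ S, f i = j := fun i hi => by simp [hf, hi]
      have hfg : ∀ i (h : i ∉ S), f i = g ⟨i, h⟩ := fun i hi => by simp [hf, hi]
      have hfj : ∀ i, f i = j ↔ i ∈ S := fun i =>
        ⟨fun h => by_contra fun hi => (g ⟨i, hi⟩).2 (hfg i hi ▸ h), hfS i⟩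
      have hcj : ({k | f k = j} : Finset ι) = S := by
        ext k
        simp [hfj]
      have hcl : ∀ l : {j' // j' ≠ j}, #{k | f k = l} = #{k | g k = l} := by
        intro l
        symm
        refine card_bij (fun k _ => k.1) ?_ (fun _ _ _ _ h => Subtype.ext h) ?_
        · intro k hk
          simp only [mem_filter, mem_univ, true_and] at hk ⊢
          rw [hfg k k.2, hk]
        · intro k hk
          simp only [mem_filter, mem_univ, true_and] at hk
          have hkS : k ∉ S := fun h => l.2 (hk ▸ hfS k h)
          refine ⟨⟨k, hkS⟩, ?_, rfl⟩
          simp only [mem_filter, mem_univ, true_and]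
          exact Subtype.ext ((hfg k hkS).symm.trans hk)
      refine ⟨f, fun i => ?_, fun l => ?_⟩
      · by_cases hi : i ∈ S
        · rw [hfS i hi, hcj, hS, hSa i hi]
        · rw [hfg i hi, hcl]
          exact hg1 ⟨i, hi⟩
      · by_cases hl : l = j
        · subst hl
          exact Or.inr fun i i' hi hi' => hSp i ((hfj i).1 hi) i' ((hfj i').1 hi')
        · refine (hg2 ⟨l, hl⟩).imp (fun h => (hcl ⟨l, hl⟩).trans_le h) fun h i i' hi hi' => ?_
          have hiS : i ∉ S := fun h => hl (hi ▸ hfS i h)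
          have hiS' : i' ∉ S := fun h => hl (hi' ▸ hfS i' h)
          exact h ⟨i, hiS⟩ ⟨i', hiS'⟩ (Subtype.ext ((hfg i hiS).symm.trans hi))
            (Subtype.ext ((hfg i' hiS').symm.trans hi'))
    -- With no such `S`, each of the two types contributes at most `c j` full entries to column `j`,
    -- hence at most `2 * c j` in all.
    · have hle : ∀ (j : J) (q : ι → Prop), (∀ i i', q i → q i' → (p i j ↔ p i' j)) →
          #{i | a i j = c j + 1 ∧ q i} ≤ c j := by
        intro j q hq
        by_contra! hlt
        obtain ⟨S, hSs, hS⟩ := exists_subset_card_eq (Nat.succ_le_of_lt hlt)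
        refine hmono ⟨j, S, hS, fun i hi => (mem_filter.1 (hSs hi)).2.1, fun i hi i' hi' => ?_⟩
        exact hq i i' (mem_filter.1 (hSs hi)).2.2 (mem_filter.1 (hSs hi')).2.2
      obtain ⟨g, hg⟩ := exists_assignment_of_card_le a c ha (fun j => by
        have h1 := hle j (fun i => p i j) (fun _ _ h h' => iff_of_true h h')
        have h2 := hle j (fun i => ¬ p i j) (fun _ _ h h' => iff_of_false h h')
        have h3 := card_filter_add_card_filter_not (s := {i | a i j = c j + 1}) (fun i => p i j)
        rw [filter_filter, filter_filter] at h3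
        calc #{i | a i j = c j + 1} = _ := h3.symm
          _ ≤ c j + c j := add_le_add (le_of_eq_of_le (by congr!) h1) (le_of_eq_of_le (by congr!) h2)
          _ = 2 * c j := (two_mul _).symm) hsum
      refine ⟨g, fun i => (hg i).trans (min_le_left _ _), fun j => Or.inl ?_⟩
      by_cases h : ∃ i, g i = j
      · obtain ⟨i, rfl⟩ := h
        exact (hg i).trans (min_le_right _ _)
      · have : ({k | g k = j} : Finset ι) = ∅ := by
          rw [filter_eq_empty_iff]
          exact fun i _ hi => h ⟨i, hi⟩
        rw [this]
        simp

/-! ### Large independent sets in a cycle -/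

section Cycle

lemma cycleGraph_adj_iff {l : ℕ} (hl : 3 ≤ l) (u v : Fin l) :
    (SimpleGraph.cycleGraph l).Adj u v ↔
      u.1 + 1 = v.1 ∨ v.1 + 1 = u.1 ∨ (u.1 = 0 ∧ v.1 + 1 = l) ∨ (v.1 = 0 ∧ u.1 + 1 = l) := by
  have key : ∀ a b : Fin l, (a - b).1 = 1 ↔ b.1 + 1 = a.1 ∨ (a.1 = 0 ∧ b.1 + 1 = l) := by
    intro a b
    have ha := a.2
    have hb := b.2
    rw [Fin.sub_def]
    simp only
    rcases lt_or_ge a.1 b.1 with h | h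
    · rw [Nat.mod_eq_of_lt (by lia)]
      lia
    · rw [show l - b.1 + a.1 = (a.1 - b.1) + l by lia, Nat.add_mod_right,
        Nat.mod_eq_of_lt (by lia)]
      lia
  rw [SimpleGraph.cycleGraph_adj', key, key]
  tauto

variable {n : ℕ}

lemma disjoint_image_add_one_of_isIndepSet {A : Finset (Fin (n + 2))}
    (hA : (SimpleGraph.cycleGraph (n + 2)).IsIndepSet A) : Disjoint A (A.image (· + 1)) := by
  rw [Finset.disjoint_left]
  intro x hx hx'
  obtain ⟨y, hy, rfl⟩ := mem_image.1 hx'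
  have hadj : (SimpleGraph.cycleGraph (n + 2)).Adj (y + 1) y :=
    SimpleGraph.cycleGraph_adj.2 (Or.inl (by simp))
  exact hA hx hy hadj.ne hadj

lemma card_image_add_one (A : Finset (Fin (n + 2))) : #(A.image (· + 1)) = #A :=
  card_image_of_injective _ (add_left_injective 1)

lemma two_mul_card_le_of_isIndepSet {A : Finset (Fin (n + 2))}
    (hA : (SimpleGraph.cycleGraph (n + 2)).IsIndepSet A) : 2 * #A ≤ n + 2 := by
  have h := card_le_univ (A ∪ A.image (· + 1))
  rw [card_union_of_disjoint (disjoint_image_add_one_of_isIndepSet hA), card_image_add_one,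
    Fintype.card_fin] at h
  lia

/-- The shift of `A` by one is disjoint from `A`; at half the vertices or more it must be the whole
complement, so membership alternates around the cycle. -/
lemma add_one_mem_iff_of_isIndepSet {A : Finset (Fin (n + 2))}
    (hA : (SimpleGraph.cycleGraph (n + 2)).IsIndepSet A) (hcard : n + 2 ≤ 2 * #A)
    (x : Fin (n + 2)) : x + 1 ∈ A ↔ x ∉ A := by
  have hsub : A.image (· + 1) ⊆ Aᶜ := fun y hy =>
    mem_compl.2 (Finset.disjoint_right.1 (disjoint_image_add_one_of_isIndepSet hA) hy)
  have heq : A.image (· + 1) = Aᶜ := eq_of_subset_of_card_le hsub (by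
    rw [card_image_add_one, card_compl, Fintype.card_fin]
    lia)
  have h : x + 1 ∈ A.image (· + 1) ↔ x ∈ A := by simp
  rw [heq, mem_compl] at h
  tauto

/-- An independent set of a cycle that contains at least half of the vertices is determined by
whether it contains the vertex `0`. -/
lemma eq_of_isIndepSet_of_card {A B : Finset (Fin (n + 2))}
    (hA : (SimpleGraph.cycleGraph (n + 2)).IsIndepSet A)
    (hB : (SimpleGraph.cycleGraph (n + 2)).IsIndepSet B) (hcA : n + 2 ≤ 2 * #A)
    (hcB : n + 2 ≤ 2 * #B) (h0 : 0 ∈ A ↔ 0 ∈ B) : A = B := by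
  ext x
  induction x using Fin.induction with
  | zero => exact h0
  | succ i ih =>
    rw [← Fin.coeSucc_eq_succ, add_one_mem_iff_of_isIndepSet hA hcA,
      add_one_mem_iff_of_isIndepSet hB hcB, ih]

end Cycle

/-! ### Components of maximum degree at most two, via longest paths -/

section Components

variable {V : Type*} (G : SimpleGraph V)

/-- The first `k` terms of `f` are the vertices of a path of `G` inside `C`. -/
structure IsPathSeq (C : Set V) (k : ℕ) (f : ℕ → V) : Prop where
  mem : ∀ i < k, f i ∈ C
  inj : ∀ i < k, ∀ j < k, f i = f j → i = j
  adj : ∀ i, i + 1 < k → G.Adj (f i) (f (i + 1))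

variable {G} {C : Set V} {k : ℕ} {f : ℕ → V}

lemma IsPathSeq.reverse (h : IsPathSeq G C k f) : IsPathSeq G C k (fun i => f (k - 1 - i)) where
  mem i hi := h.mem _ (by lia)
  inj i hi j hj hij := by
    have := h.inj _ (by lia) _ (by lia) hij
    lia
  adj i hi := by
    have := h.adj (k - 1 - (i + 1)) (by lia)
    rw [show k - 1 - (i + 1) + 1 = k - 1 - i by lia] at this
    exact this.symm

lemma IsPathSeq.cons (h : IsPathSeq G C k f) {w : V} (hw : w ∈ C) (hadj : G.Adj w (f 0))
    (hne : ∀ i < k, f i ≠ w) : IsPathSeq G C (k + 1) (fun i => Nat.casesOn i w f) where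
  mem i hi := by
    cases i with
    | zero => exact hw
    | succ i => exact h.mem i (by lia)
  inj i hi j hj hij := by
    cases i with
    | zero =>
      cases j with
      | zero => rfl
      | succ j => exact absurd hij.symm (hne j (by lia))
    | succ i =>
      cases j with
      | zero => exact absurd hij (hne i (by lia))
      | succ j => rw [h.inj i (by lia) j (by lia) hij]
  adj i hi := by
    cases i with
    | zero => exact hadj
    | succ i => exact h.adj i (by lia)

lemma exists_maximal_isPathSeq [Fintype V] {v : V} (hv : v ∈ C) :
    ∃ k f, 1 ≤ k ∧ IsPathSeq G C k f ∧ ∀ k' f', IsPathSeq G C k' f' → k' ≤ k := by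
  classical
  have hbound : ∀ k, (∃ f, IsPathSeq G C k f) → k ≤ Fintype.card V := by
    rintro k ⟨f, hf⟩
    have : Function.Injective fun i : Fin k => f i :=
      fun i j hij => Fin.ext (hf.inj i i.2 j j.2 hij)
    simpa using Fintype.card_le_of_injective _ this
  have hone : ∃ f, IsPathSeq G C 1 f :=
    ⟨fun _ => v, fun _ _ => hv, fun i hi j hj _ => by lia, fun i hi => by lia⟩
  obtain ⟨f, hf⟩ := Nat.findGreatest_spec (P := fun k => ∃ f, IsPathSeq G C k f)
    (hbound 1 hone) hone
  exact ⟨_, f, Nat.le_findGreatest (hbound 1 hone) hone, hf,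
    fun k' f' h' => Nat.le_findGreatest (hbound k' ⟨f', h'⟩) ⟨f', h'⟩⟩

lemma IsPathSeq.adj_zero_mem (h : IsPathSeq G C k f)
    (hmax : ∀ k' f', IsPathSeq G C k' f' → k' ≤ k) {w : V} (hw : w ∈ C) (hadj : G.Adj w (f 0)) :
    ∃ i < k, f i = w := by
  by_contra! hne
  have := hmax _ _ (h.cons hw hadj hne)
  lia

lemma IsPathSeq.adj_interior (h : IsPathSeq G C k f)
    (hdeg : ∀ v a b c, G.Adj v a → G.Adj v b → G.Adj v c → a = b ∨ a = c ∨ b = c)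
    {i : ℕ} (hi : i + 2 < k) {w : V} (hadj : G.Adj w (f (i + 1))) : f i = w ∨ f (i + 2) = w := by
  rcases hdeg _ _ _ _ (h.adj i (by lia)).symm (h.adj (i + 1) hi) hadj.symm with h1 | h1 | h1
  · have := h.inj i (by lia) (i + 2) hi h1
    lia
  · exact Or.inl h1
  · exact Or.inr h1

/-- An interior vertex already has its two neighbours on the path. A neighbour of an end lies on the
path by maximality; if it is interior, the degree bound makes it consecutive to that end. -/
lemma IsPathSeq.adj_maximal (h : IsPathSeq G C k f)
    (hmax : ∀ k' f', IsPathSeq G C k' f' → k' ≤ k)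
    (hdeg : ∀ v a b c, G.Adj v a → G.Adj v b → G.Adj v c → a = b ∨ a = c ∨ b = c)
    {i : ℕ} (hi : i < k) {w : V} (hw : w ∈ C) (hadj : G.Adj w (f i)) :
    ∃ j < k, f j = w ∧ (j = i + 1 ∨ i = j + 1 ∨ (i = 0 ∧ j + 1 = k) ∨ (j = 0 ∧ i + 1 = k)) := by
  have hint : ∀ i < k, 0 < i → i + 1 < k → ∀ w, G.Adj w (f i) →
      ∃ j < k, f j = w ∧ (j = i + 1 ∨ i = j + 1) := by
    intro i hi h0 h1 w hadj
    obtain ⟨i, rfl⟩ := Nat.exists_eq_succ_of_ne_zero h0.ne'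
    rcases h.adj_interior hdeg h1 hadj with h2 | h2
    · exact ⟨i, by lia, h2, by lia⟩
    · exact ⟨i + 2, by lia, h2, by lia⟩
  by_cases hi' : 0 < i ∧ i + 1 < k
  · obtain ⟨j, hj, hjw, hij⟩ := hint i hi hi'.1 hi'.2 w hadj
    exact ⟨j, hj, hjw, by lia⟩
  have hmem : ∃ j < k, f j = w := by
    by_cases h0 : i = 0
    · subst h0
      exact h.adj_zero_mem hmax hw hadj
    · have hik : i = k - 1 := by lia
      subst hik
      obtain ⟨j, hj, hjw⟩ := h.reverse.adj_zero_mem hmax hw (by simpa using hadj)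
      exact ⟨k - 1 - j, by lia, hjw⟩
  obtain ⟨j, hj, rfl⟩ := hmem
  refine ⟨j, hj, rfl, ?_⟩
  have hne : i ≠ j := by
    rintro rfl
    exact hadj.ne rfl
  by_cases hj' : 0 < j ∧ j + 1 < k
  · obtain ⟨i', hi'k, hii, hij⟩ := hint j hj hj'.1 hj'.2 _ hadj.symm
    have := h.inj i' hi'k i hi hii
    lia
  · lia

/-- A connected component of a graph of maximum degree at most two is an induced subgraph of a
cycle. -/
lemma exists_embedding_cycleGraph [Fintype V]
    (hdeg : ∀ v a b c, G.Adj v a → G.Adj v b → G.Adj v c → a = b ∨ a = c ∨ b = c)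
    (C : G.ConnectedComponent) :
    ∃ n : ℕ, ∃ φ : V → Fin (n + 3), Set.InjOn φ C.supp ∧ ∀ u ∈ C.supp, ∀ v ∈ C.supp,
      (G.Adj u v ↔ (SimpleGraph.cycleGraph (n + 3)).Adj (φ u) (φ v)) := by
  classical
  obtain ⟨v, hv⟩ := C.nonempty_supp
  obtain ⟨k, f, hk, hf, hmax⟩ := exists_maximal_isPathSeq (G := G) hv
  have hadjmem : ∀ {u w}, u ∈ C.supp → G.Adj u w → w ∈ C.supp := fun hu hadj =>
    (C.mem_supp_congr_adj hadj).1 hu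
  have hsurj : ∀ w ∈ C.supp, ∃ i < k, f i = w := by
    intro w hw
    have hreach : G.Reachable (f 0) w := by
      have h1 := (C.mem_supp_iff _).1 (hf.mem 0 hk)
      have h2 := (C.mem_supp_iff _).1 hw
      exact SimpleGraph.ConnectedComponent.exact (h1.trans h2.symm)
    rw [SimpleGraph.reachable_iff_reflTransGen] at hreach
    induction hreach with
    | refl => exact ⟨0, hk, rfl⟩
    | tail _ hadj ih =>
      obtain ⟨i, hi, rfl⟩ := ih (hadjmem hw hadj.symm)
      obtain ⟨j, hj, hjw, -⟩ := hf.adj_maximal hmax hdeg hi hw hadj.symm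
      exact ⟨j, hj, hjw⟩
  choose! idx hidx hfidx using hsurj
  have hinj : ∀ u ∈ C.supp, ∀ v ∈ C.supp, idx u = idx v → u = v := fun u hu v hv h => by
    rw [← hfidx u hu, ← hfidx v hv, h]
  have hadj : ∀ u ∈ C.supp, ∀ v ∈ C.supp, G.Adj u v →
      (idx u + 1 = idx v ∨ idx v + 1 = idx u ∨ (idx u = 0 ∧ idx v + 1 = k) ∨
        (idx v = 0 ∧ idx u + 1 = k)) := by
    intro u hu v hv h
    obtain ⟨j, hj, hju, hij⟩ := hf.adj_maximal hmax hdeg (hidx v hv) hu (by rwa [hfidx v hv])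
    have : j = idx u := hf.inj j hj _ (hidx u hu) (hju.trans (hfidx u hu).symm)
    lia
  have hsucc : ∀ u ∈ C.supp, ∀ v ∈ C.supp, idx u + 1 = idx v → G.Adj u v := by
    intro u hu v hv h
    have := hf.adj (idx u) (h ▸ hidx v hv)
    rwa [h, hfidx u hu, hfidx v hv] at this
  -- The longest path covers the component, which is therefore a cycle if the ends close up and a
  -- path otherwise.
  by_cases hclosed : 3 ≤ k ∧ G.Adj (f 0) (f (k - 1))
  · obtain ⟨hk3, hends⟩ := hclosed
    obtain ⟨n, rfl⟩ := Nat.exists_eq_add_of_le' hk3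
    have hval : ∀ u ∈ C.supp, (Fin.ofNat (n + 3) (idx u)).1 = idx u := fun u hu => by
      simpa using Nat.mod_eq_of_lt (hidx u hu)
    have hwrap : ∀ u ∈ C.supp, ∀ v ∈ C.supp, idx u = 0 → idx v + 1 = n + 3 → G.Adj u v := by
      intro u hu v hv h0 h1
      rw [← hfidx u hu, ← hfidx v hv, h0]
      rwa [← h1] at hends
    refine ⟨n, fun u => Fin.ofNat _ (idx u), fun u hu v hv h => hinj u hu v hv ?_,
      fun u hu v hv => ?_⟩
    · rw [← hval u hu, ← hval v hv]
      exact congrArg Fin.val h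
    · rw [cycleGraph_adj_iff (by lia), hval u hu, hval v hv]
      refine ⟨hadj u hu v hv, ?_⟩
      rintro (h | h | h | h)
      · exact hsucc u hu v hv h
      · exact (hsucc v hv u hu h).symm
      · exact hwrap u hu v hv h.1 h.2
      · exact (hwrap v hv u hu h.1 h.2).symm
  -- A path on `k` vertices is placed in a cycle of length `k + 3`; the unused vertices rule out
  -- wrap-around adjacencies.
  · have hval : ∀ u ∈ C.supp, (Fin.ofNat (k + 3) (idx u)).1 = idx u := fun u hu => by
      have := hidx u hu
      simpa using Nat.mod_eq_of_lt (show idx u < k + 3 by lia)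
    have hopen : ∀ u ∈ C.supp, ∀ v ∈ C.supp, G.Adj u v → idx u = 0 → idx v + 1 = k →
        idx u + 1 = idx v := by
      intro u hu v hv h h0 h1
      have hne : idx u ≠ idx v := fun he => h.ne (hinj u hu v hv he)
      by_contra hn
      refine hclosed ⟨by lia, ?_⟩
      rwa [← h1, Nat.add_sub_cancel, ← h0, hfidx u hu, hfidx v hv]
    refine ⟨k, fun u => Fin.ofNat _ (idx u), fun u hu v hv h => hinj u hu v hv ?_,
      fun u hu v hv => ?_⟩
    · rw [← hval u hu, ← hval v hv]
      exact congrArg Fin.val h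
    · rw [cycleGraph_adj_iff (by lia), hval u hu, hval v hv]
      have hu' := hidx u hu
      have hv' := hidx v hv
      constructor
      · intro h
        rcases hadj u hu v hv h with h1 | h1 | h1 | h1
        · exact Or.inl h1
        · exact Or.inr (Or.inl h1)
        · exact Or.inl (hopen u hu v hv h h1.1 h1.2)
        · exact Or.inr (Or.inl (hopen v hv u hu h.symm h1.1 h1.2))
      · rintro (h | h | h | h)
        · exact hsucc u hu v hv h
        · exact (hsucc v hv u hu h).symm
        · lia
        · lia

end Components

/-! ### Representatives inside a component, and their assembly -/

section Rainbow

lemma forcesRainbow_of_rainbowNumber_eq {V : Type*} {G : SimpleGraph V} {n m k : ℕ}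
    (h : rainbowNumber G n m = k) : ForcesRainbow G n m k := by
  by_contra hk
  have hle : ((k + 1 : ℕ) : ℕ∞) ≤ rainbowNumber G n m := by
    refine le_iInf₂ fun k' hk' => ?_
    have h1 : rainbowNumber G n m ≤ k' := iInf₂_le k' hk'
    rw [h, Nat.cast_le] at h1
    have hne : k' ≠ k := fun he => hk (he ▸ hk')
    exact Nat.cast_le.2 (by lia)
  rw [h, Nat.cast_le] at hle
  lia

lemma le_rainbowNumber {V : Type*} {G : SimpleGraph V} {n m : ℕ}
    (h : ∃ I : Finset V, G.IsNIndepSet n I) : (m : ℕ∞) ≤ rainbowNumber G n m := by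
  obtain ⟨I, hI⟩ := h
  refine le_iInf₂ fun k hk => Nat.cast_le.2 ?_
  obtain ⟨R, hR, c, hc, -⟩ := hk (fun _ => I) fun _ => hI
  have := Fintype.card_le_of_injective c hc
  rwa [Fintype.card_coe, hR.card_eq, Fintype.card_fin] at this

/-- A family of as many sets as the size of the rainbow independent sets that it is forced to have
admits an independent system of distinct representatives. -/
lemma ForcesRainbow.exists_representatives {V ι : Type*} {G : SimpleGraph V} {S : Finset ι}
    (h : ForcesRainbow G (#S) (#S) (#S)) (A : S → Finset V)
    (hA : ∀ i, G.IsNIndepSet (#S) (A i)) :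
    ∃ x : S → V, (∀ i : S, x i ∈ A i) ∧ Function.Injective x ∧ ∀ i j, ¬ G.Adj (x i) (x j) := by
  obtain ⟨R, hR, c, hc, hmem⟩ := h (fun t => A (S.equivFin.symm t)) fun t => hA _
  have hbij : Function.Bijective c := (Fintype.bijective_iff_injective_and_card c).2
    ⟨hc, by rw [Fintype.card_coe, hR.card_eq, Fintype.card_fin]⟩
  let e := (Equiv.ofBijective c hbij).symm
  refine ⟨fun i => e (S.equivFin i), fun i => ?_, ?_, fun i j hadj => ?_⟩
  · have h1 := hmem (e (S.equivFin i))
    have h2 : c (e (S.equivFin i)) = S.equivFin i :=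
      (Equiv.ofBijective c hbij).apply_symm_apply _
    simpa only [h2, Equiv.symm_apply_apply] using h1
  · exact Subtype.val_injective.comp (e.injective.comp S.equivFin.injective)
  · exact hR.isIndepSet (e (S.equivFin i)).2 (e (S.equivFin j)).2 hadj.ne hadj

variable {V ι : Type*} {G : SimpleGraph V} {n : ℕ} {C : Set V} {φ : V → Fin (n + 3)}

lemma isIndepSet_image [DecidableEq V] (hadj : ∀ u ∈ C, ∀ v ∈ C,
      (G.Adj u v ↔ (SimpleGraph.cycleGraph (n + 3)).Adj (φ u) (φ v)))
    {A : Finset V} (hAC : (A : Set V) ⊆ C) (hA : G.IsIndepSet A) :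
    (SimpleGraph.cycleGraph (n + 3)).IsIndepSet (A.image φ : Finset (Fin (n + 3))) := by
  intro x hx y hy hne h
  obtain ⟨u, hu, rfl⟩ := mem_image.1 (mem_coe.1 hx)
  obtain ⟨v, hv, rfl⟩ := mem_image.1 (mem_coe.1 hy)
  have huv := (hadj u (hAC hu) v (hAC hv)).2 h
  exact hA hu hv huv.ne huv

/-- Independent subsets of an induced subgraph of a cycle, each at least as large as their number,
have an independent system of distinct representatives, provided that the cycle is long enough for
`hforces` to apply or that all these sets agree on the vertex `0` of the cycle. -/
lemma exists_representatives_of_embedding [DecidableEq V] (hφ : Set.InjOn φ C)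
    (hadj : ∀ u ∈ C, ∀ v ∈ C, (G.Adj u v ↔ (SimpleGraph.cycleGraph (n + 3)).Adj (φ u) (φ v)))
    (hforces : ∀ m, 1 ≤ m → 2 * m + 1 ≤ n + 3 →
      ForcesRainbow (SimpleGraph.cycleGraph (n + 3)) m m m)
    (S : Finset ι) (A : ι → Finset V) (hAC : ∀ i ∈ S, (A i : Set V) ⊆ C)
    (hA : ∀ i ∈ S, G.IsIndepSet (A i)) (hcard : ∀ i ∈ S, #S ≤ #(A i))
    (hS : 2 * #S + 1 ≤ n + 3 ∨
      ∀ i ∈ S, ∀ j ∈ S, (0 ∈ (A i).image φ ↔ 0 ∈ (A j).image φ)) :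
    ∃ x : S → V, (∀ i : S, x i ∈ A i) ∧ Function.Injective x ∧ ∀ i j, ¬ G.Adj (x i) (x j) := by
  rcases S.eq_empty_or_nonempty with rfl | hne
  · exact ⟨fun i => absurd i.2 (notMem_empty _), fun i => absurd i.2 (notMem_empty _),
      fun i => absurd i.2 (notMem_empty _), fun i => absurd i.2 (notMem_empty _)⟩
  by_cases hlen : 2 * #S + 1 ≤ n + 3
  -- The hypothesis on cycles needs sets of size exactly `#S`, so the given ones are shrunk.
  · have hB : ∀ i : S, ∃ B ⊆ A i, #B = #S := fun i => exists_subset_card_eq (hcard i i.2)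
    choose B hBA hBc using hB
    have hBC : ∀ i : S, (B i : Set V) ⊆ C := fun i v hv => hAC i i.2 (hBA i hv)
    obtain ⟨y, hy, hyinj, hyadj⟩ := (hforces _ hne.card_pos hlen).exists_representatives
      (fun i => (B i).image φ) fun i =>
        ⟨isIndepSet_image hadj (hBC i) ((hA i i.2).mono (hBA i)),
          (card_image_of_injOn (hφ.mono (hBC i))).trans (hBc i)⟩
    have hx : ∀ i : S, ∃ v ∈ B i, φ v = y i := fun i => mem_image.1 (hy i)
    choose x hxB hxy using hx
    refine ⟨x, fun i => hBA i (hxB i), fun i j hij => hyinj ?_, fun i j h => hyadj i j ?_⟩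
    · rw [← hxy, ← hxy, hij]
    · rw [← hxy, ← hxy]
      exact (hadj _ (hBC i (hxB i)) _ (hBC j (hxB j))).1 h
  -- Here every set has at least half the vertices of the cycle, so agreement on `0` makes them all
  -- equal, and distinct elements of the common set serve as representatives.
  · have hS0 := hS.resolve_left hlen
    have hindep := fun i hi => isIndepSet_image hadj (hAC i hi) (hA i hi)
    have himg : ∀ i ∈ S, #((A i).image φ) = #(A i) := fun i hi =>
      card_image_of_injOn (hφ.mono (hAC i hi))
    have hlarge : ∀ i ∈ S, n + 1 + 2 ≤ 2 * #((A i).image φ) := fun i hi => by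
      have := hcard i hi
      rw [himg i hi]
      lia
    obtain ⟨i₀, hi₀⟩ := hne
    have hsame : ∀ i ∈ S, A i = A i₀ := by
      intro i hi
      have heq : (A i).image φ = (A i₀).image φ := eq_of_isIndepSet_of_card (hindep i hi)
        (hindep i₀ hi₀) (hlarge i hi) (hlarge i₀ hi₀) (hS0 i hi i₀ hi₀)
      have := (hφ.image_eq_image_iff (hAC i hi) (hAC i₀ hi₀)).1 (by
        rw [← coe_image, ← coe_image, heq])
      exact_mod_cast this
    obtain ⟨e⟩ := Function.Embedding.nonempty_of_card_le (α := S) (β := A i₀)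
      (by simpa using hcard i₀ hi₀)
    refine ⟨fun i => e i, fun i => (hsame i i.2).symm ▸ (e i).2,
      fun i j h => e.injective (Subtype.ext h), fun i j h => ?_⟩
    exact hA i₀ hi₀ (e i).2 (e j).2 h.ne h

/-- If the cycles satisfy `f(m, m) = m` as soon as they have more than `2 * m` vertices, then in a
finite graph without vertices of degree three or more, fewer than `n` independent `n`-sets always
have an independent system of distinct representatives. -/
theorem forcesRainbow_of_degree_le_two [Fintype V]
    (hcycle : ∀ m l : ℕ, 1 ≤ m → 2 * m + 1 ≤ l → ForcesRainbow (SimpleGraph.cycleGraph l) m m m)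
    (hdeg : ∀ v a b c, G.Adj v a → G.Adj v b → G.Adj v c → a = b ∨ a = c ∨ b = c)
    {n k : ℕ} (hk : k < n) : ForcesRainbow G n k k := by
  classical
  intro F hF
  choose l φ hφ hadj using exists_embedding_cycleGraph (G := G) hdeg
  let _ : Fintype G.ConnectedComponent := Fintype.ofFinite _
  let A : Fin k → G.ConnectedComponent → Finset V := fun i C =>
    {v ∈ F i | G.connectedComponentMk v = C}
  have hAF : ∀ i C, A i C ⊆ F i := fun i C => filter_subset _ _
  have hAC : ∀ i C, (A i C : Set V) ⊆ C.supp := fun i C v hv => (mem_filter.1 (mem_coe.1 hv)).2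
  have hA : ∀ i C, G.IsIndepSet (A i C) := fun i C => (hF i).isIndepSet.mono (hAF i C)
  -- The component lies in a cycle of length `l C + 3`, and `(l C + 2) / 2` is the largest `m` with
  -- `2 * m + 1 ≤ l C + 3`. The type of a trace records which alternating class it is when it is
  -- full.
  obtain ⟨g, hg1, hg2⟩ := exists_assignment (fun i C => #(A i C)) (fun C => (l C + 2) / 2)
    (fun i C => 0 ∈ (A i C).image (φ C))
    (fun i C => by
      have h := two_mul_card_le_of_isIndepSet (isIndepSet_image (hadj C) (hAC i C) (hA i C))
      rw [card_image_of_injOn ((hφ C).mono (hAC i C))] at h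
      lia)
    (fun i => by
      have h := card_eq_sum_card_fiberwise (f := G.connectedComponentMk) (s := F i) (t := univ)
        (by simp)
      rw [Fintype.card_fin, ← h, (hF i).card_eq]
      exact hk)
  have hrep := fun C => exists_representatives_of_embedding (hφ C) (hadj C)
    (fun m hm hl => hcycle m _ hm hl) ({i | g i = C} : Finset (Fin k)) (fun i => A i C)
    (fun i _ => hAC i C) (fun i _ => hA i C)
    (fun i hi => by
      obtain rfl := (mem_filter.1 hi).2
      exact hg1 i)
    ((hg2 C).imp (fun h => by lia) fun h i hi j hj =>
      h i j (mem_filter.1 hi).2 (mem_filter.1 hj).2)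
  choose x hxA hxinj hxadj using hrep
  let y : Fin k → V := fun i => x (g i) ⟨i, by simp⟩
  have hyA : ∀ i, y i ∈ A i (g i) := fun i => hxA _ _
  have hyx : ∀ i C (h : g i = C), y i = x C ⟨i, by simpa using h⟩ := by
    rintro i _ rfl
    rfl
  have hyC : ∀ i, G.connectedComponentMk (y i) = g i := fun i => (mem_filter.1 (hyA i)).2
  have hyinj : Function.Injective y := by
    intro i j hij
    have hgij : g j = g i := by rw [← hyC, ← hyC, hij]
    rw [hyx i _ rfl, hyx j _ hgij] at hij
    exact congrArg Subtype.val (hxinj _ hij)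
  have hyadj : ∀ i j, ¬ G.Adj (y i) (y j) := by
    intro i j h
    have hgij : g j = g i := by
      rw [← hyC, ← hyC, SimpleGraph.ConnectedComponent.connectedComponentMk_eq_of_adj h]
    rw [hyx i _ rfl, hyx j _ hgij] at h
    exact hxadj _ _ _ h
  refine ⟨univ.image y, ⟨?_, by simp [card_image_of_injective _ hyinj]⟩, ?_⟩
  · intro u hu v hv _
    obtain ⟨i, -, rfl⟩ := mem_image.1 (mem_coe.1 hu)
    obtain ⟨j, -, rfl⟩ := mem_image.1 (mem_coe.1 hv)
    exact hyadj i j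
  · have hpre : ∀ v : (univ.image y : Finset V), ∃ i, y i = v := fun v => by
      obtain ⟨i, -, hi⟩ := mem_image.1 v.2
      exact ⟨i, hi⟩
    choose c hc using hpre
    refine ⟨c, fun u v h => Subtype.ext ?_, fun v => ?_⟩
    · rw [← hc u, ← hc v, h]
    · rw [← hc v]
      exact hAF _ _ (hyA _)

lemma eq_or_eq_or_eq_of_maxDegree_le_two [Fintype V] [DecidableRel G.Adj]
    (hdeg : G.maxDegree ≤ 2) (v a b c : V) (ha : G.Adj v a) (hb : G.Adj v b) (hc : G.Adj v c) :
    a = b ∨ a = c ∨ b = c := by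
  classical
  by_contra! h
  have hsub : ({a, b, c} : Finset V) ⊆ G.neighborFinset v := by
    intro w hw
    simp only [mem_insert, mem_singleton] at hw
    rcases hw with rfl | rfl | rfl <;> simpa
  have h1 := card_le_card hsub
  rw [card_eq_three.2 ⟨a, b, c, h.1, h.2.1, h.2.2, rfl⟩, G.card_neighborFinset_eq_degree] at h1
  have h2 := G.degree_le_maxDegree v
  lia

end Rainbow

end RainbowIndep

/-- The bound `heven` on the number of even cycles is not needed: the exchange argument behind
`RainbowIndep.exists_assignment` handles any number of them. -/
theorem theorem2
    (hcycle : ∀ m l : ℕ, 1 ≤ m → 2 * m + 1 ≤ l →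
      RainbowIndep.rainbowNumber (SimpleGraph.cycleGraph l) m m = (m : ℕ∞))
    {V : Type*} [Fintype V] (G : SimpleGraph V) [DecidableRel G.Adj]
    (hdeg : G.maxDegree ≤ 2)
    (heven : RainbowIndep.numEvenCycles G ≤ 4)
    (n : ℕ) (hn : 1 ≤ n)
    (hindep : ∃ I : Finset V, G.IsNIndepSet n I) :
    RainbowIndep.rainbowNumber G n (n - 1) = ((n - 1 : ℕ) : ℕ∞) := by
  refine le_antisymm (iInf₂_le (n - 1) ?_) (RainbowIndep.le_rainbowNumber hindep)
  exact RainbowIndep.forcesRainbow_of_degree_le_two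
    (fun m l hm hl => RainbowIndep.forcesRainbow_of_rainbowNumber_eq (hcycle m l hm hl))
    (RainbowIndep.eq_or_eq_or_eq_of_maxDegree_le_two hdeg) (by lia)
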